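/- Let $G$ be a strongly connected finite directed graph, which may have multiple edges but no loops, with vertex set $V$, and fix a vertex $s\in V$, called the sink. For each vertex $x\neq s$ fix a cyclic ordering of the edges emanating from $x$. A rotor configuration $T$ assigns to each $x\neq s$ an edge $T(x)$ emanating from $x$. In a step of rotor-router walk, a chip located at $x\ne s$ first increments the rotor at $x$, replacing $T(x)$ by the next edge in the cyclic ordering at $x$, and then moves along this new edge. For a vertex $x$, let $e_x(T)$ be the rotor configuration that results from starting a chip at $x$ with rotors $T$ and letting it walk until it first reaches $s$. Let $\mathrm{Rec}(G)$ be the set of oriented spanning trees rooted at $s$, that is, of rotor configurations $T$ whose edges $\{T(x)\}_{x\neq s}$ contain no directed cycle. Then the chip always reaches the sink after finitely many steps, from every rotor configuration and every starting vertex, so that $e_x$ is well defined, and each $e_x$ restricts to a permutation of $\mathrm{Rec}(G)$. Let the rotor-router group $RR(G)$ be the subgroup of the group of permutations of $\mathrm{Rec}(G)$ that is generated by $\{e_x\}_{x\neq s}$, and let the sandpile group be the quotient \[ SP(G)=\mathbb{Z}^V\big/\langle\, s,\ \Delta_x : x\in V,\ x\neq s\,\rangle, \qquad \Delta_x=\sum_{y\in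 V}d_{xy}\,y-d_x\,x, \] where $d_{xy}$ is the number of edges from $x$ to $y$ and $d_x=\sum_{y\in V} d_{xy}$. Then $RR(G)\simeq SP(G)$ as groups. -/

import Mathlib

/-! A directed multigraph is a quiver: the edges from `x` to `y` are the elements of `x ⟶ y`,
and the edges emanating from `x` are the elements of `Quiver.Star x`, the target of `a` being
`a.1`. The sink is a vertex `s`. -/

universe u v

namespace RotorRouter

variable {V : Type u} [Quiver.{v} V]

/-- A rotor configuration: each non-sink vertex `x` is assigned an edge emanating from `x`. -/
abbrev RotorConfig (s : V) : Type (max u v) :=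
  ∀ x : {x : V // x ≠ s}, Quiver.Star (x : V)

/-- A cyclic ordering of the edges emanating from each non-sink vertex, given by the successor
permutation, which has to be one single cycle through all the edges emanating from the vertex. -/
structure CyclicOrderings (s : V) where
  /-- the edge that follows a given edge -/
  next : ∀ x : {x : V // x ≠ s}, Equiv.Perm (Quiver.Star (x : V))
  isCycleOn : ∀ x, (next x).IsCycleOn Set.univ

/-- In the configuration `T`, the vertex `x` is not the sink and its rotor points to `y`. -/
def PointsTo {s : V} (T : RotorConfig s) (x y : V) : Prop :=
  ∃ h : x ≠ s, (T ⟨x, h⟩).1 = y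

/-- The rotors of `T` contain no directed cycle, that is, they form an oriented spanning tree
(rooted at the sink). -/
def IsOrientedSpanningTree {s : V} (T : RotorConfig s) : Prop :=
  ∀ x : V, ¬ Relation.TransGen (PointsTo T) x x

/-- The set of oriented spanning trees rooted at `s`. -/
def Rec (s : V) : Set (RotorConfig s) :=
  {T | IsOrientedSpanningTree T}

open Classical in
/-- One step of rotor-router walk, on pairs (rotor configuration, location of the chip): the rotor
at the location of the chip is moved to the next edge, and then the chip moves along this new edge.
A chip at the sink stays there. -/
noncomputable def step {s : V} (ρ : CyclicOrderings s) (p : RotorConfig s × V) :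
    RotorConfig s × V :=
  if h : p.2 ≠ s then
    (Function.update p.1 ⟨p.2, h⟩ (ρ.next ⟨p.2, h⟩ (p.1 ⟨p.2, h⟩)),
      (ρ.next ⟨p.2, h⟩ (p.1 ⟨p.2, h⟩)).1)
  else p

/-- A chip started at `x` with rotors `T` reaches the sink after finitely many steps. -/
def ReachesSink {s : V} (ρ : CyclicOrderings s) (x : V) (T : RotorConfig s) : Prop :=
  ∃ n : ℕ, ((step ρ)^[n] (T, x)).2 = s

open Classical in
/-- The chip-addition operator `e_x`: the rotor configuration that results from starting a chip
at `x` and letting it walk until it first reaches the sink. (The default value `T` is used only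
for a chip that never reaches the sink.) -/
noncomputable def addChip {s : V} (ρ : CyclicOrderings s) (x : V) (T : RotorConfig s) :
    RotorConfig s :=
  if h : ReachesSink ρ x T then ((step ρ)^[Nat.find h] (T, x)).1 else T

/-- The rotor-router group: the subgroup of the permutation group of the set of oriented spanning
trees that is generated by the operators `e_x`, `x ≠ s`. -/
def rotorRouterGroup {s : V} (ρ : CyclicOrderings s) : Subgroup (Equiv.Perm (Rec s)) :=
  Subgroup.closure
    {σ | ∃ x : V, x ≠ s ∧ ∀ T : Rec s, (σ T : RotorConfig s) = addChip ρ x (T : RotorConfig s)}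

section Sandpile

variable [Fintype V] [DecidableEq V] [∀ x y : V, Fintype (x ⟶ y)]

/-- The number `d_{xy}` of edges from `x` to `y`. -/
def edgeCount (x y : V) : ℕ := Fintype.card (x ⟶ y)

/-- The outdegree `d_x` of `x`. -/
def outdeg (x : V) : ℕ := ∑ y : V, edgeCount x y

/-- `Δ_x = ∑_y d_{xy} y - d_x x` in `ℤ^V`. -/
def laplacian (x : V) : V → ℤ :=
  (∑ y : V, (edgeCount x y : ℤ) • (Pi.single y 1 : V → ℤ))
    - (outdeg x : ℤ) • (Pi.single x 1 : V → ℤ)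

/-- The subgroup of `ℤ^V` generated by `s` and the `Δ_x` of the non-sink vertices `x`. -/
def sandpileRelations (s : V) : AddSubgroup (V → ℤ) :=
  AddSubgroup.closure
    ({(Pi.single s 1 : V → ℤ)} ∪ {w : V → ℤ | ∃ x : V, x ≠ s ∧ w = laplacian x})

/-- The sandpile group `ℤ^V / (s, Δ_x)_{x ≠ s}`. -/
abbrev SandpileGroup (s : V) : Type u := (V → ℤ) ⧸ sandpileRelations s

end Sandpile

end RotorRouter

/-! The oriented spanning trees form a torsor for the sandpile group, on which `e_x` acts as
translation by the class of `x`. Give each edge a potential in the sandpile group such that turning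
the rotor at `x` onto an edge with target `y` adds `[x] - [y]`; this closes up around the cyclic
ordering because `Δ_x` is a relation (`exists_isPotential`). The sum of the rotor potentials plus
the class of the chip is then invariant under a step, so `e_x` adds `[x]` to the total potential
(`IsPotential.sum_addChip`).

The total potential is injective on trees (`IsPotential.injOn`): two trees of equal potential differ
by rotor arcs which, corrected by full turns, form a conserved flow, and `IsConserved.nonpos`,
applied to this flow and its negative, forces it to vanish. It is surjective because a tree exists
and the vertex classes generate. Transported along this bijection, the rotor-router group is the
image of the faithful regular representation of the sandpile group. -/

namespace RotorRouter

/-! ### Sums along a cyclic permutation. -/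

section Cycle

variable {α : Type*} [Fintype α] {f : Equiv.Perm α}

/-- A function with total sum zero on a cycle is a coboundary. -/
theorem exists_coboundary {A : Type*} [AddCommGroup A] (hf : f.IsCycleOn Set.univ) (g : α → A)
    (hg : ∑ a, g a = 0) : ∃ h : α → A, ∀ a, h (f a) = h a + g (f a) := by
  classical
  rcases isEmpty_or_nonempty α with hα | ⟨⟨a₀⟩⟩
  · exact ⟨fun _ => 0, fun a => (hα.false a).elim⟩
  have hf' : f.IsCycleOn (Finset.univ : Finset α) := by simpa using hf
  -- Partial sums of `g` along the orbit, starting with `g (f a₀)`. Total sum zero makes them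
  -- periodic, so they descend to a function on the cycle.
  have hS : Function.Periodic (fun n : ℕ => ∑ i ∈ Finset.range n, g ((f ^ i) (f a₀)))
      (Finset.univ : Finset α).card := by
    intro n
    have hinj : Set.InjOn (fun i : ℕ => (f ^ i) ((f ^ n) (f a₀)))
        (Finset.range (Finset.univ : Finset α).card) := by
      intro i hi j hj hij
      have := (hf'.pow_apply_eq_pow_apply (Finset.mem_univ _)).1 hij
      exact Nat.ModEq.eq_of_lt_of_lt this (by simpa using hi) (by simpa using hj)
    have hall : ∑ i ∈ Finset.range (Finset.univ : Finset α).card, g ((f ^ (n + i)) (f a₀)) = 0 := by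
      have himg : (Finset.range (Finset.univ : Finset α).card).image
          (fun i : ℕ => (f ^ i) ((f ^ n) (f a₀))) = Finset.univ := by
        apply Finset.eq_univ_of_card
        rw [Finset.card_image_of_injOn hinj, Finset.card_range, Finset.card_univ]
      have h := Finset.sum_image (f := g) hinj
      rw [himg, hg] at h
      rw [h]
      refine Finset.sum_congr rfl fun i _ => ?_
      rw [add_comm n i, pow_add, Equiv.Perm.mul_apply]
    change ∑ i ∈ Finset.range (n + _), _ = _
    rw [Finset.sum_range_add, hall, add_zero]
  choose k hk using fun a => hf'.exists_pow_eq' (Finset.finite_toSet _)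
    (Finset.mem_univ a₀) (Finset.mem_univ a)
  refine ⟨fun a => ∑ i ∈ Finset.range (k a), g ((f ^ i) (f a₀)), fun a => ?_⟩
  have h1 : k (f a) ≡ k a + 1 [MOD (Finset.univ : Finset α).card] := by
    rw [← hf'.pow_apply_eq_pow_apply (Finset.mem_univ a₀), hk, pow_succ', Equiv.Perm.mul_apply, hk]
  have h2 := hS.map_mod_nat (k (f a))
  have h3 := hS.map_mod_nat (k a + 1)
  rw [h1] at h2
  have h4 := h2.symm.trans h3
  beta_reduce
  rw [h4, Finset.sum_range_succ, ← Equiv.Perm.mul_apply, ← pow_succ, pow_succ',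
    Equiv.Perm.mul_apply, hk]

/-- The indicator of the arc of a cycle that leads from `a` (excluded) to `b` (included). -/
theorem exists_arc (hf : f.IsCycleOn Set.univ) (a b : α) :
    ∃ ε : α → ℤ, (∀ c, ε a ≤ ε c ∧ ε c ≤ ε b) ∧ ε b ≤ ε a + 1 ∧ (ε a = ε b → a = b) ∧
      ∀ {A : Type*} [AddCommGroup A] (g h : α → A), (∀ c, h (f c) = h c + g (f c)) →
        h b - h a = ∑ c, ε c • g c := by
  classical
  have hf' : f.IsCycleOn (Finset.univ : Finset α) := by simpa using hf
  -- Here `n` is less than the cycle length: the arc never comes back to `a`, and for `a = b` it is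
  -- empty rather than a full turn.
  obtain ⟨n, hn, rfl⟩ := hf'.exists_pow_eq (Finset.mem_univ a) (Finset.mem_univ b)
  have hinj : Set.InjOn (fun i : ℕ => (f ^ (i + 1)) a) (Finset.range n) := by
    intro i hi j hj hij
    have := (hf'.pow_apply_eq_pow_apply (Finset.mem_univ _)).1 hij
    simp only [Finset.coe_range, Set.mem_Iio] at hi hj
    have := Nat.ModEq.eq_of_lt_of_lt this (by omega) (by omega)
    omega
  have hS (c : α) : 0 ≤ (if c ∈ (Finset.range n).image (fun i : ℕ => (f ^ (i + 1)) a)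
      then (1 : ℤ) else 0) ∧ (if c ∈ (Finset.range n).image (fun i : ℕ => (f ^ (i + 1)) a)
      then (1 : ℤ) else 0) ≤ 1 := by
    split_ifs <;> simp
  have ha : a ∉ (Finset.range n).image (fun i : ℕ => (f ^ (i + 1)) a) := by
    simp only [Finset.mem_image, Finset.mem_range, not_exists, not_and]
    intro i hi h
    have := Nat.le_of_dvd (by omega) ((hf'.pow_apply_eq (Finset.mem_univ a)).1 h)
    omega
  refine ⟨fun c => if c ∈ (Finset.range n).image (fun i : ℕ => (f ^ (i + 1)) a) then 1 else 0,
    ?_, ?_, ?_, ?_⟩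
  · intro c
    rcases Nat.eq_zero_or_pos n with rfl | h0
    · simp
    · have hb : (f ^ n) a ∈ (Finset.range n).image (fun i : ℕ => (f ^ (i + 1)) a) :=
        Finset.mem_image.2 ⟨n - 1, by simpa using h0, by simp [Nat.sub_add_cancel h0]⟩
      simp only [ha, hb, if_true, if_false]
      exact hS c
  · simp only [ha, if_false]
    exact (hS _).2
  · rcases Nat.eq_zero_or_pos n with rfl | h0
    · simp
    · have hb : (f ^ n) a ∈ (Finset.range n).image (fun i : ℕ => (f ^ (i + 1)) a) :=
        Finset.mem_image.2 ⟨n - 1, by simpa using h0, by simp [Nat.sub_add_cancel h0]⟩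
      simp only [ha, hb, if_true, if_false]
      simp
  · intro A _ g h hgh
    simp only [ite_smul, one_smul, zero_smul, Finset.sum_ite_mem, Finset.univ_inter]
    rw [Finset.sum_image hinj]
    clear * - hgh
    induction n with
    | zero => simp
    | succ n ih =>
      rw [Finset.sum_range_succ, ← ih, pow_succ', Equiv.Perm.mul_apply, hgh]
      abel

end Cycle

variable {V : Type u} [Quiver.{v} V] {s : V}

/-! ### Oriented spanning trees as rotors that all lead to the sink. -/

section Trees

theorem not_pointsTo_sink (T : RotorConfig s) (y : V) : ¬ PointsTo T s y :=
  fun ⟨h, _⟩ => h rfl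

theorem PointsTo.eq {T : RotorConfig s} {x y z : V} (h : PointsTo T x y) (h' : PointsTo T x z) :
    y = z := by
  obtain ⟨_, rfl⟩ := h
  obtain ⟨_, rfl⟩ := h'
  rfl

theorem isOrientedSpanningTree_of_reaches {T : RotorConfig s}
    (h : ∀ y, Relation.ReflTransGen (PointsTo T) y s) : IsOrientedSpanningTree T := by
  intro x
  refine Relation.ReflTransGen.head_induction_on (motive := fun x _ =>
    ¬ Relation.TransGen (PointsTo T) x x) (h x) ?_ ?_
  · intro hs
    obtain ⟨y, hy, _⟩ := Relation.TransGen.head'_iff.1 hs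
    exact not_pointsTo_sink T y hy
  · intro a c hac _ ih ha
    obtain ⟨y, hy, hya⟩ := Relation.TransGen.head'_iff.1 ha
    obtain rfl := hac.eq hy
    exact ih (Relation.TransGen.tail' hya hac)

theorem IsOrientedSpanningTree.reaches [Finite V] {T : RotorConfig s}
    (h : IsOrientedSpanningTree T) (y : V) : Relation.ReflTransGen (PointsTo T) y s := by
  let r : V → V → Prop := fun a b => Relation.TransGen (PointsTo T) b a
  have : IsTrans V r := ⟨fun _ _ _ hab hbc => hbc.trans hab⟩
  have : Std.Irrefl r := ⟨h⟩
  induction y using (Finite.wellFounded_of_trans_of_irrefl r).induction with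
  | _ y ih =>
    by_cases hy : y = s
    · rw [hy]
    · have hp : PointsTo T y (T ⟨y, hy⟩).1 := ⟨hy, rfl⟩
      exact .head hp (ih _ (.single hp))

theorem exists_isOrientedSpanningTree (hV : Quiver.IsStronglyConnected V) :
    ∃ T : RotorConfig s, IsOrientedSpanningTree T := by
  classical
  have hex (y : V) : ∃ n, ∃ p : Quiver.Path y s, p.length = n := by
    obtain ⟨p⟩ := hV y s
    exact ⟨_, p, rfl⟩
  -- The distance to the sink; rotors along which it decreases form a tree.
  let d (y : V) : ℕ := Nat.find (hex y)
  have hd (y : {x : V // x ≠ s}) : ∃ a : Quiver.Star (y : V), d a.1 < d y := by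
    obtain ⟨p, hp⟩ := Nat.find_spec (hex y)
    rcases hn : d y with _ | n
    · exact (y.2 (p.eq_of_length_zero (hp.trans hn))).elim
    · obtain ⟨c, e, q, hq, -⟩ := Quiver.Path.eq_toPath_comp_of_length_eq_succ p (hp.trans hn)
      exact ⟨⟨c, e⟩, Nat.lt_succ_of_le (Nat.find_min' _ ⟨q, hq⟩)⟩
  choose T hT using hd
  refine ⟨T, isOrientedSpanningTree_of_reaches fun y => ?_⟩
  induction hn : d y using Nat.strong_induction_on generalizing y with
  | _ n ih =>
    by_cases hy : y = s
    · rw [hy]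
    · exact .head (⟨hy, rfl⟩ : PointsTo T y (T ⟨y, hy⟩).1) (ih _ (hn ▸ hT ⟨y, hy⟩) _ rfl)

end Trees

/-! ### The rotor walk: invariants and termination. -/

section Walk

variable (ρ : CyclicOrderings s)

theorem step_sink (T : RotorConfig s) : step ρ (T, s) = (T, s) := by
  simp [step]

theorem step_of_ne (T : RotorConfig s) {x : V} (hx : x ≠ s) [DecidableEq {x : V // x ≠ s}] :
    step ρ (T, x) = (Function.update T ⟨x, hx⟩ (ρ.next ⟨x, hx⟩ (T ⟨x, hx⟩)),
      (ρ.next ⟨x, hx⟩ (T ⟨x, hx⟩)).1) := by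
  simp only [step, ne_eq, hx, not_false_eq_true, dite_true, Prod.mk.injEq, and_true]
  congr!

theorem step_snd {p : RotorConfig s × V} (hx : p.2 ≠ s) :
    (step ρ p).2 = (ρ.next ⟨p.2, hx⟩ (p.1 ⟨p.2, hx⟩)).1 := by
  classical
  exact congrArg Prod.snd (step_of_ne ρ p.1 hx)

theorem step_fst_self {p : RotorConfig s × V} (hx : p.2 ≠ s) :
    (step ρ p).1 ⟨p.2, hx⟩ = ρ.next ⟨p.2, hx⟩ (p.1 ⟨p.2, hx⟩) := by
  classical
  rw [show step ρ p = _ from step_of_ne ρ p.1 hx]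
  simp

theorem step_fst_of_ne {p : RotorConfig s × V} (y : {x : V // x ≠ s}) (h : p.2 ≠ y) :
    (step ρ p).1 y = p.1 y := by
  classical
  by_cases hx : p.2 = s
  · obtain ⟨T, x⟩ := p
    obtain rfl : x = s := hx
    rw [step_sink]
  · rw [show step ρ p = _ from step_of_ne ρ p.1 hx]
    exact Function.update_of_ne (fun e => h (congrArg Subtype.val e).symm) _ _

/-- A property of pairs (rotors, chip) that is preserved by the steps of the walk holds at the end
of the walk. -/
theorem addChip_induction {P : RotorConfig s × V → Prop} {x : V} {T : RotorConfig s}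
    (hr : ReachesSink ρ x T) (h0 : P (T, x)) (hstep : ∀ p, P p → P (step ρ p)) :
    P (addChip ρ x T, s) := by
  classical
  have hP (n : ℕ) : P ((step ρ)^[n] (T, x)) := by
    induction n with
    | zero => exact h0
    | succ n ih => rw [Function.iterate_succ_apply']; exact hstep _ ih
  have hs := Nat.find_spec hr
  have := hP (Nat.find hr)
  rw [show (step ρ)^[Nat.find hr] (T, x) = (((step ρ)^[Nat.find hr] (T, x)).1, s) from
    Prod.ext rfl hs] at this
  rw [addChip, dif_pos hr]
  convert this

/-- If all rotors lead to the sink before the walk, so they do after the walk. -/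
theorem addChip_reaches {x : V} {T : RotorConfig s} (hr : ReachesSink ρ x T)
    (hT : ∀ y, Relation.ReflTransGen (PointsTo T) y s) (y : V) :
    Relation.ReflTransGen (PointsTo (addChip ρ x T)) y s := by
  classical
  -- Invariant: from every vertex the rotors lead to the sink or to the chip. It survives a step
  -- because the vertex just left points to the new location of the chip.
  refine (addChip_induction ρ (P := fun p => ∀ y, ∃ z, (z = s ∨ z = p.2) ∧
    Relation.ReflTransGen (PointsTo p.1) y z) hr (fun y => ⟨s, .inl rfl, hT y⟩) ?_ y).elim ?_
  · rintro p hp y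
    by_cases hx : p.2 = s
    · obtain ⟨T, x⟩ := p
      obtain rfl : x = s := hx
      rw [step_sink]
      exact hp y
    obtain ⟨z, hz, hyz⟩ := hp y
    have hpp : PointsTo (step ρ p).1 p.2 (step ρ p).2 :=
      ⟨hx, by rw [step_fst_self, step_snd ρ hx]⟩
    refine Relation.ReflTransGen.head_induction_on hyz ?_ ?_
    · rcases hz with rfl | rfl
      · exact ⟨z, .inl rfl, .refl⟩
      · exact ⟨_, .inr rfl, .single hpp⟩
    · rintro a c ⟨ha, rfl⟩ _ ⟨w, hw, hcw⟩
      by_cases hap : p.2 = a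
      · subst hap
        exact ⟨_, .inr rfl, .single hpp⟩
      · exact ⟨w, hw, .head ⟨ha, by rw [step_fst_of_ne ρ ⟨a, ha⟩ hap]⟩ hcw⟩
  · rintro z ⟨rfl | rfl, h⟩ <;> exact h

open Filter in
/-- The chip always reaches the sink. -/
theorem reachesSink [Finite V] [∀ x y : V, Finite (x ⟶ y)] (hV : Quiver.IsStronglyConnected V)
    (x : V) (T : RotorConfig s) : ReachesSink ρ x T := by
  by_contra hcon
  rw [ReachesSink, not_exists] at hcon
  set p : ℕ → RotorConfig s × V := fun n => (step ρ)^[n] (T, x) with hp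
  have hsucc (n : ℕ) : p (n + 1) = step ρ (p n) := Function.iterate_succ_apply' _ _ _
  have hne (n : ℕ) : (p n).2 ≠ s := hcon n
  have pigeonhole {ι : Type (max u v)} [Finite ι] {P : ℕ → ι → Prop}
      (h : ∃ᶠ n in atTop, ∃ i, P n i) : ∃ i, ∃ᶠ n in atTop, P n i := by
    by_contra! hc
    exact h ((eventually_all.2 hc).mono fun n hn ⟨i, hi⟩ => hn i hi)
  -- A non-sink vertex visited infinitely often sends the chip along each of its edges infinitely
  -- often; strong connectivity then spreads recurrence to the sink.
  have key (y : V) (hys : y ≠ s) (hy : ∃ᶠ n in atTop, (p n).2 = y) (b : Quiver.Star y) :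
      ∃ᶠ n in atTop, (p n).2 = b.1 := by
    have hnext (a : Quiver.Star y) (ha : ∃ᶠ n in atTop, (p n).2 = y ∧ (p n).1 ⟨y, hys⟩ = a) :
        ∃ᶠ n in atTop, (p n).2 = y ∧ (p n).1 ⟨y, hys⟩ = ρ.next ⟨y, hys⟩ a := by
      classical
      rw [frequently_atTop] at ha hy ⊢
      intro N
      obtain ⟨n, hn, rfl, hna⟩ := ha N
      have hex := hy (n + 1)
      -- The first return to the vertex: its rotor has not moved in between.
      refine ⟨Nat.find hex, by have := (Nat.find_spec hex).1; omega, (Nat.find_spec hex).2, ?_⟩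
      have hk (k : ℕ) (hk : n + 1 ≤ k) : k ≤ Nat.find hex →
          (p k).1 ⟨(p n).2, hys⟩ = ρ.next ⟨(p n).2, hys⟩ a := by
        induction k, hk using Nat.le_induction with
        | base => intro _; rw [hsucc, step_fst_self, hna]
        | succ k hnk ih =>
          intro hkf
          rw [hsucc, step_fst_of_ne ρ _ fun e => Nat.find_min hex (by omega) ⟨hnk, e⟩]
          exact ih (by omega)
      exact hk _ (Nat.find_spec hex).1 le_rfl
    obtain ⟨a, ha⟩ : ∃ a, ∃ᶠ n in atTop, (p n).2 = y ∧ (p n).1 ⟨y, hys⟩ = a := by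
      obtain ⟨a, ha⟩ := pigeonhole (ι := ULift.{max u v} (Quiver.Star y))
        (P := fun n a => (p n).2 = y ∧ (p n).1 ⟨y, hys⟩ = a.down)
        (hy.mono fun n hn => ⟨⟨(p n).1 ⟨y, hys⟩⟩, hn, rfl⟩)
      exact ⟨a.down, ha⟩
    have hpow (k : ℕ) : ∃ᶠ n in atTop, (p n).2 = y ∧
        (p n).1 ⟨y, hys⟩ = (ρ.next ⟨y, hys⟩ ^ k) a := by
      induction k with
      | zero => exact ha
      | succ k ih => rw [pow_succ', Equiv.Perm.mul_apply]; exact hnext _ ih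
    -- The rotor turns before the chip moves, so it must show the predecessor of `b`.
    obtain ⟨k, hk⟩ := (ρ.isCycleOn ⟨y, hys⟩).exists_pow_eq' Set.finite_univ (Set.mem_univ a)
      (Set.mem_univ ((ρ.next ⟨y, hys⟩).symm b))
    have hb := hpow k
    rw [hk, frequently_atTop] at hb
    rw [frequently_atTop]
    intro N
    obtain ⟨n, hn, rfl, hnb⟩ := hb N
    exact ⟨n + 1, by omega, by rw [hsucc, step_snd ρ hys, hnb, Equiv.apply_symm_apply]⟩
  obtain ⟨y, hy⟩ : ∃ y, ∃ᶠ n in atTop, (p n).2 = y := by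
    obtain ⟨y, hy⟩ := pigeonhole (ι := ULift.{max u v} V) (P := fun n y => (p n).2 = y.down)
      (Frequently.of_forall fun n => ⟨⟨(p n).2⟩, rfl⟩)
    exact ⟨y.down, hy⟩
  have hall (z : V) (q : Quiver.Path y z) : ∃ᶠ n in atTop, (p n).2 = z := by
    induction q with
    | nil => exact hy
    | @cons b c q e ih =>
      obtain ⟨n, hn⟩ := ih.exists
      exact key b (hn ▸ hne n) ih ⟨c, e⟩
  obtain ⟨q⟩ := hV y s
  obtain ⟨n, hn⟩ := (hall s q).exists
  exact hne n hn

end Walk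

/-! ### Conserved flows dominated by a tree. -/

section Flow

variable [Fintype V] [DecidableEq V] [∀ x y : V, Fintype (x ⟶ y)]

/-- Conservation of a flow at the vertices other than the sink. -/
def IsConserved (N : ∀ x : {x : V // x ≠ s}, Quiver.Star (x : V) → ℤ) : Prop :=
  ∀ z : V, z ≠ s → ∑ x, ∑ b, N x b * ((Pi.single (x : V) 1 : V → ℤ) z - (Pi.single b.1 1 : V → ℤ) z) = 0

theorem IsConserved.neg {N : ∀ x : {x : V // x ≠ s}, Quiver.Star (x : V) → ℤ}
    (h : IsConserved N) : IsConserved (fun x b => - N x b) := by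
  intro z hz
  simpa [Finset.sum_neg_distrib] using h z hz

/-- A conserved flow that is carried by no edge more than by the edges of an oriented spanning
tree, up to one unit, is nonpositive. -/
theorem IsConserved.nonpos {N : ∀ x : {x : V // x ≠ s}, Quiver.Star (x : V) → ℤ}
    (hN : IsConserved N) {T : RotorConfig s} (hT : IsOrientedSpanningTree T)
    (h1 : ∀ x b, N x b ≤ N x (T x)) (h2 : ∀ x b, N x (T x) ≤ N x b + 1)
    (x : {x : V // x ≠ s}) (b : Quiver.Star (x : V)) : N x b ≤ 0 := by
  classical
  -- Sum conservation over `U`, where the tree edge carries positive flow. Edges leaving `U` carry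
  -- at least `0`, edges entering it at most `0`, so every crossing edge carries exactly `0`. Tree
  -- edges thus cannot leave `U`, yet they lead to `s ∉ U`; hence `U` is empty.
  let U : Finset V := Finset.univ.filter fun z => ∃ h : z ≠ s, 1 ≤ N ⟨z, h⟩ (T ⟨z, h⟩)
  have hUs : s ∉ U := by simp [U]
  have hmem (x : {x : V // x ≠ s}) : (x : V) ∈ U ↔ 1 ≤ N x (T x) := by
    simp [U, x.2]
  have hsum : ∑ x, ∑ b,
      N x b * ((if (x : V) ∈ U then 1 else 0) - if b.1 ∈ U then 1 else 0) = 0 := by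
    have : ∑ z ∈ U, ∑ x, ∑ b,
        N x b * ((Pi.single (x : V) 1 : V → ℤ) z - (Pi.single b.1 1 : V → ℤ) z) = 0 :=
      Finset.sum_eq_zero fun z hz => hN z fun h => hUs (h ▸ hz)
    rw [Finset.sum_comm] at this
    refine Eq.trans ?_ this
    refine Finset.sum_congr rfl fun x _ => ?_
    rw [Finset.sum_comm]
    refine Finset.sum_congr rfl fun b _ => ?_
    rw [← Finset.mul_sum]
    simp [Pi.single_apply, Finset.sum_sub_distrib]
  have hterm (x) (b) :
      0 ≤ N x b * ((if (x : V) ∈ U then 1 else 0) - if b.1 ∈ U then 1 else 0) := by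
    have := h1 x b
    have := h2 x b
    by_cases hx : (x : V) ∈ U <;> by_cases hb : b.1 ∈ U <;> simp only [hx, hb, if_true, if_false] <;>
      rw [hmem] at hx <;> simp <;> omega
  have hzero (x) (b) :
      N x b * ((if (x : V) ∈ U then 1 else 0) - if b.1 ∈ U then 1 else 0) = 0 := by
    rw [Finset.sum_eq_zero_iff_of_nonneg fun x _ => Finset.sum_nonneg fun b _ => hterm x b] at hsum
    exact (Finset.sum_eq_zero_iff_of_nonneg fun b _ => hterm x b).1 (hsum x (Finset.mem_univ _)) b
      (Finset.mem_univ _)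
  have hclosed (a) (ha : Relation.ReflTransGen (PointsTo T) a s) : a ∉ U := by
    refine Relation.ReflTransGen.head_induction_on ha hUs ?_
    rintro a c ⟨has, rfl⟩ _ hc haU
    have hz := hzero ⟨a, has⟩ (T ⟨a, has⟩)
    simp only [haU, hc, if_true, if_false] at hz
    have := (hmem ⟨a, has⟩).1 haU
    omega
  have := hclosed x (hT.reaches x)
  rw [hmem] at this
  have := h1 x b
  omega

end Flow

/-! ### The potential, and the torsor structure on trees. -/

section Potential

variable [Fintype V] [DecidableEq V] [∀ x y : V, Fintype (x ⟶ y)]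

/-- The class of a chip at `x` in the sandpile group. -/
def chipClass (s x : V) : SandpileGroup s :=
  QuotientAddGroup.mk (Pi.single x 1)

theorem chipClass_sink : chipClass s s = 0 :=
  (QuotientAddGroup.eq_zero_iff _).2 (AddSubgroup.subset_closure (.inl rfl))

theorem laplacian_eq_sum_star (x : V) :
    laplacian x = ∑ b : Quiver.Star x, ((Pi.single b.1 1 : V → ℤ) - Pi.single x 1) := by
  rw [laplacian, outdeg, Fintype.sum_sigma]
  simp [edgeCount, Finset.sum_sub_distrib, Finset.sum_smul]

theorem sum_star_chipClass {x : V} (hx : x ≠ s) :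
    ∑ b : Quiver.Star x, (chipClass s x - chipClass s b.1) = 0 := by
  have h : (QuotientAddGroup.mk' (sandpileRelations s)) (laplacian x) = 0 :=
    (QuotientAddGroup.eq_zero_iff _).2 (AddSubgroup.subset_closure (.inr ⟨x, hx, rfl⟩))
  rw [laplacian_eq_sum_star, map_sum, ← neg_eq_zero, ← Finset.sum_neg_distrib] at h
  rw [← h]
  refine Finset.sum_congr rfl fun b _ => ?_
  rw [map_sub, neg_sub]
  rfl

theorem closure_chipClass :
    AddSubgroup.closure {g : SandpileGroup s | ∃ x, x ≠ s ∧ g = chipClass s x} = ⊤ := by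
  refine eq_top_iff.2 fun q _ => ?_
  obtain ⟨w, rfl⟩ := QuotientAddGroup.mk'_surjective _ q
  have hw : w = ∑ x, w x • (Pi.single x 1 : V → ℤ) := by
    simp [← Pi.single_smul, Finset.univ_sum_single]
  rw [hw, map_sum]
  refine AddSubgroup.sum_mem _ fun x _ => ?_
  rw [map_zsmul]
  refine AddSubgroup.zsmul_mem _ (?_ : chipClass s x ∈ _) _
  by_cases hx : x = s
  · rw [hx, chipClass_sink]
    exact AddSubgroup.zero_mem _
  · exact AddSubgroup.subset_closure ⟨x, hx, rfl⟩

/-- The generator `s` vanishes away from the sink, so only the Laplacians contribute there. -/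
theorem exists_of_mem_sandpileRelations {w : V → ℤ} (hw : w ∈ sandpileRelations s) :
    ∃ m : {x : V // x ≠ s} → ℤ, ∀ z, z ≠ s → w z = ∑ x, m x * laplacian (x : V) z := by
  induction hw using AddSubgroup.closure_induction with
  | mem w hw =>
    rcases hw with rfl | ⟨x, hx, rfl⟩
    · exact ⟨0, fun z hz => by simp [hz]⟩
    · exact ⟨Pi.single ⟨x, hx⟩ 1, fun z hz => by simp [Pi.single_apply]⟩
  | zero => exact ⟨0, fun z hz => by simp⟩
  | add w w' _ _ h h' =>
    obtain ⟨m, hm⟩ := h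
    obtain ⟨m', hm'⟩ := h'
    exact ⟨m + m', fun z hz => by simp [hm z hz, hm' z hz, add_mul, Finset.sum_add_distrib]⟩
  | neg w _ h =>
    obtain ⟨m, hm⟩ := h
    exact ⟨-m, fun z hz => by simp [hm z hz, Finset.sum_neg_distrib]⟩

/-- A potential on the edges: when a rotor is moved, its potential changes by the chips that the
vertex loses. -/
def IsPotential (ρ : CyclicOrderings s)
    (h : ∀ x : {x : V // x ≠ s}, Quiver.Star (x : V) → SandpileGroup s) : Prop :=
  ∀ x a, h x (ρ.next x a) = h x a + (chipClass s x - chipClass s (ρ.next x a).1)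

theorem exists_isPotential (ρ : CyclicOrderings s) : ∃ h, IsPotential ρ h := by
  choose h hh using fun x : {x : V // x ≠ s} => exists_coboundary (ρ.isCycleOn x)
    (fun b => chipClass s (x : V) - chipClass s b.1) (sum_star_chipClass x.2)
  exact ⟨h, hh⟩

variable {ρ : CyclicOrderings s}
  {h : ∀ x : {x : V // x ≠ s}, Quiver.Star (x : V) → SandpileGroup s}

theorem IsPotential.sum_step (hh : IsPotential ρ h) (p : RotorConfig s × V) :
    ∑ x, h x ((step ρ p).1 x) + chipClass s (step ρ p).2 = ∑ x, h x (p.1 x) + chipClass s p.2 := by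
  by_cases hx : p.2 = s
  · obtain ⟨T, x⟩ := p
    obtain rfl : x = s := hx
    rw [step_sink]
  · rw [← Finset.add_sum_erase _ _ (Finset.mem_univ ⟨p.2, hx⟩),
      ← Finset.add_sum_erase _ (fun x => h x (p.1 x)) (Finset.mem_univ ⟨p.2, hx⟩),
      step_fst_self, step_snd ρ hx, hh]
    rw [Finset.sum_congr rfl fun y hy => by
      rw [step_fst_of_ne ρ y fun e => (Finset.mem_erase.1 hy).1 (Subtype.ext e.symm)]]
    abel

theorem IsPotential.sum_addChip (hh : IsPotential ρ h) {x : V} {T : RotorConfig s}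
    (hr : ReachesSink ρ x T) :
    ∑ y, h y (addChip ρ x T y) = ∑ y, h y (T y) + chipClass s x := by
  have := addChip_induction ρ (P := fun p => ∑ y, h y (p.1 y) + chipClass s p.2 =
    ∑ y, h y (T y) + chipClass s x) hr rfl fun p hp => (hh.sum_step p).trans hp
  simpa [chipClass_sink] using this

/-- Oriented spanning trees are determined by their potentials. -/
theorem IsPotential.injOn (hh : IsPotential ρ h) :
    Set.InjOn (fun T : RotorConfig s => ∑ x, h x (T x)) (Rec s) := by
  intro T hT T' hT' hTT'
  choose ε h1 h2 h3 h4 using fun x => exists_arc (ρ.isCycleOn x) (T x) (T' x)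
  have hmem : ∑ x, ∑ b, ε x b • ((Pi.single (x : V) 1 : V → ℤ) - Pi.single b.1 1) ∈
      sandpileRelations s := by
    rw [← QuotientAddGroup.eq_zero_iff, ← QuotientAddGroup.mk'_apply, map_sum]
    have : ∑ x, (h x (T' x) - h x (T x)) = 0 := by
      rw [Finset.sum_sub_distrib, sub_eq_zero]
      exact hTT'.symm
    rw [← this]
    refine Finset.sum_congr rfl fun x _ => ?_
    rw [h4 x (fun b => chipClass s (x : V) - chipClass s b.1) (h x) (hh x), map_sum]
    refine Finset.sum_congr rfl fun b _ => ?_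
    rw [map_zsmul, map_sub]
    rfl
  obtain ⟨m, hm⟩ := exists_of_mem_sandpileRelations hmem
  -- Adding `m x` means full turns of the rotor at `x`; it is the same on all edges at `x`, so
  -- comparisons between them are unaffected.
  have hN : IsConserved fun x b => ε x b + m x := by
    intro z hz
    have := hm z hz
    simp only [laplacian_eq_sum_star, Finset.sum_apply, Finset.mul_sum] at this
    rw [← sub_eq_zero, ← Finset.sum_sub_distrib] at this
    rw [← this]
    refine Finset.sum_congr rfl fun x _ => ?_
    rw [← Finset.sum_sub_distrib]
    refine Finset.sum_congr rfl fun b _ => ?_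
    simp only [Pi.smul_apply, Pi.sub_apply, smul_eq_mul]
    ring
  -- The flow is largest on the edges of `T'`, its negative on those of `T`.
  have hle := hN.nonpos hT' (fun x b => by linarith [(h1 x b).2])
    (fun x b => by linarith [(h1 x b).1, h2 x])
  have hge := hN.neg.nonpos hT (fun x b => by linarith [(h1 x b).1])
    (fun x b => by linarith [(h1 x b).2, h2 x])
  funext x
  refine h3 x ?_
  linarith [hle x (T x), hle x (T' x), hge x (T x), hge x (T' x)]

omit [DecidableEq V] [∀ x y : V, Fintype (x ⟶ y)] in
theorem addChip_mem_rec {x : V} {T : RotorConfig s} (hr : ReachesSink ρ x T) (hT : T ∈ Rec s) :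
    addChip ρ x T ∈ Rec s :=
  isOrientedSpanningTree_of_reaches (addChip_reaches ρ hr hT.reaches)

/-- Injectivity comes from cancelling `[x]` in the injective potential, surjectivity from
finiteness. -/
theorem bijOn_addChip (hr : ∀ x T, ReachesSink ρ x T) (x : V) :
    Set.BijOn (addChip ρ x) (Rec s) (Rec s) := by
  obtain ⟨h, hh⟩ := exists_isPotential ρ
  have hmaps : Set.MapsTo (addChip ρ x) (Rec s) (Rec s) := fun T hT => addChip_mem_rec (hr x T) hT
  have hinj : Set.InjOn (addChip ρ x) (Rec s) := by
    intro T hT T' hT' e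
    have := hh.sum_addChip (hr x T)
    rw [e, hh.sum_addChip (hr x T')] at this
    exact hh.injOn hT hT' (add_right_cancel this).symm
  refine ⟨hmaps, hinj, fun T hT => ?_⟩
  obtain ⟨T', e⟩ := Finite.surjective_of_injective (hmaps.restrict_inj.2 hinj) ⟨T, hT⟩
  exact ⟨T', T'.2, congrArg Subtype.val e⟩

/-- The potential of rotor configurations is a bijection from the oriented spanning trees to the
sandpile group. -/
theorem IsPotential.bijective (hh : IsPotential ρ h) (hV : Quiver.IsStronglyConnected V)
    (hr : ∀ x T, ReachesSink ρ x T) :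
    Function.Bijective fun T : Rec s => ∑ x, h x ((T : RotorConfig s) x) := by
  refine ⟨fun T T' e => Subtype.ext (hh.injOn T.2 T'.2 e), fun q => ?_⟩
  obtain ⟨T₀, hT₀⟩ := exists_isOrientedSpanningTree (s := s) hV
  -- An equivalence rather than an implication, so that the induction on `g` passes to inverses.
  have htrans (g : SandpileGroup s) (q : SandpileGroup s) :
      (∃ T : Rec s, ∑ x, h x ((T : RotorConfig s) x) = q) ↔
        ∃ T : Rec s, ∑ x, h x ((T : RotorConfig s) x) = q + g := by
    have hg : g ∈ AddSubgroup.closure {g : SandpileGroup s | ∃ x, x ≠ s ∧ g = chipClass s x} := by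
      rw [closure_chipClass]; trivial
    induction hg using AddSubgroup.closure_induction generalizing q with
    | mem g hg =>
      obtain ⟨x, -, rfl⟩ := hg
      constructor
      · rintro ⟨T, rfl⟩
        exact ⟨⟨_, addChip_mem_rec (hr x T) T.2⟩, hh.sum_addChip (hr x T)⟩
      · rintro ⟨T, hT⟩
        obtain ⟨T', hT', e⟩ := (bijOn_addChip hr x).surjOn T.2
        refine ⟨⟨T', hT'⟩, ?_⟩
        rw [← e, hh.sum_addChip (hr x T')] at hT
        exact add_right_cancel hT
    | zero => rw [add_zero]
    | add g g' _ _ ih ih' => rw [← add_assoc]; exact (ih q).trans (ih' _)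
    | neg g _ ih => simpa using (ih (q + -g)).symm
  have := (htrans (q - ∑ x, h x (T₀ x)) (∑ x, h x (T₀ x))).1 ⟨⟨T₀, hT₀⟩, rfl⟩
  rwa [add_sub_cancel] at this

theorem nonempty_rotorRouterGroup_mulEquiv (hV : Quiver.IsStronglyConnected V)
    (hr : ∀ x T, ReachesSink ρ x T) :
    Nonempty (rotorRouterGroup ρ ≃* Multiplicative (SandpileGroup s)) := by
  obtain ⟨h, hh⟩ := exists_isPotential ρ
  let E : Rec s ≃ Multiplicative (SandpileGroup s) :=
    (Equiv.ofBijective _ (hh.bijective hV hr)).trans Multiplicative.ofAdd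
  let ψ : Multiplicative (SandpileGroup s) →* Equiv.Perm (Rec s) :=
    E.symm.permCongrHom.toMonoidHom.comp
      (MulAction.toPermHom (Multiplicative (SandpileGroup s)) (Multiplicative (SandpileGroup s)))
  have hψ (g T) : E (ψ g T) = g * E T := by simp [ψ, Equiv.permCongr_apply]
  have hψinj : Function.Injective ψ :=
    E.symm.permCongrHom.injective.comp MulAction.toPerm_injective
  have hE (x : V) (T : Rec s) :
      E ⟨_, addChip_mem_rec (hr x T) T.2⟩ = Multiplicative.ofAdd (chipClass s x) * E T := by
    refine (congrArg Multiplicative.ofAdd (hh.sum_addChip (hr x T))).trans ?_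
    rw [add_comm]
    rfl
  have hrange : ψ.range = rotorRouterGroup ρ := by
    have htop : Subgroup.closure
        {g : Multiplicative (SandpileGroup s) | ∃ x, x ≠ s ∧ g.toAdd = chipClass s x} = ⊤ := by
      have := congrArg AddSubgroup.toSubgroup (closure_chipClass (s := s))
      rw [AddSubgroup.toSubgroup_closure] at this
      exact this
    rw [MonoidHom.range_eq_map, ← htop, MonoidHom.map_closure, rotorRouterGroup]
    congr 1
    ext σ
    constructor
    · rintro ⟨g, ⟨x, hx, hg⟩, rfl⟩
      obtain rfl : g = Multiplicative.ofAdd (chipClass s x) := hg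
      refine ⟨x, hx, fun T => ?_⟩
      exact congrArg Subtype.val (E.injective ((hψ _ T).trans (hE x T).symm))
    · rintro ⟨x, hx, hσ⟩
      refine ⟨Multiplicative.ofAdd (chipClass s x), ⟨x, hx, rfl⟩, Equiv.ext fun T => ?_⟩
      refine E.injective ((hψ _ T).trans ?_)
      rw [← hE]
      exact congrArg E (Subtype.ext (hσ T).symm)
  exact ⟨((MonoidHom.ofInjective hψinj).trans (MulEquiv.subgroupCongr hrange)).symm⟩

end Potential

end RotorRouter

theorem theorem2 {V : Type u} [Quiver.{v} V] [Fintype V] [DecidableEq V]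
    [∀ x y : V, Fintype (x ⟶ y)]
    (loopless : ∀ x : V, IsEmpty (x ⟶ x))
    (stronglyConnected : Quiver.IsStronglyConnected V)
    (s : V) (ρ : RotorRouter.CyclicOrderings s) :
    (∀ (x : V) (T : RotorRouter.RotorConfig s), RotorRouter.ReachesSink ρ x T) ∧
    (∀ x : V, Set.BijOn (RotorRouter.addChip ρ x) (RotorRouter.Rec s) (RotorRouter.Rec s)) ∧
    Nonempty
      (RotorRouter.rotorRouterGroup ρ ≃* Multiplicative (RotorRouter.SandpileGroup s)) := by
  have hr (x : V) (T : RotorRouter.RotorConfig s) : RotorRouter.ReachesSink ρ x T :=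
    RotorRouter.reachesSink ρ stronglyConnected x T
  exact ⟨hr, RotorRouter.bijOn_addChip hr,
    RotorRouter.nonempty_rotorRouterGroup_mulEquiv stronglyConnected hr⟩
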